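/- Let $V_0,V_1$ be finite-dimensional real vector spaces and $d:V_1\to V_0$ a linear map (a two-term complex $\mathbb V$). Let $\mathfrak k_1=\mathrm{Hom}(V_0,V_1)$ with bracket $[A,B]=A\,d\,B-B\,d\,A$, let $\mathfrak k_0=\{(X_0,X_1)\in \mathrm{End}(V_0)\times\mathrm{End}(V_1): X_0 d=dX_1\}$ with the componentwise commutator bracket, and put $\delta(A)=(dA,Ad)$ and $\phi_{(X_0,X_1)}(A)=X_1A-AX_0$. Then $\mathrm{End}(\mathbb V)=(\mathfrak k_1,\mathfrak k_0,\delta,\phi)$ is a crossed module of Lie algebras: $\delta$ is a Lie algebra morphism, $\phi$ is an action by derivations, $\delta(\phi_X A)=[X,\delta A]$ and $\phi_{\delta A}B=[A,B]$. Let $K_0=\{(B_0,B_1)\in GL(V_0)\times GL(V_1): B_0d=dB_1\}$, a Lie group under componentwise composition (an open subset of the vector space $\mathfrak k_0$). The open set $$K_1=\{M\in\mathrm{Hom}(V_0,V_1): I+dM\in GL(V_0)\text{ and } I+Md\in GL(V_1)\}$$ is a Lie group with multiplication $M_1\cdot M_2=M_1+M_2+M_1dM_2$, identity $0$ and inverse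 $$M^{-1}=-(I+Md)^{-1}M=-M(I+dM)^{-1}.$$ Moreover, with $$\Big(\int\delta\Big)(M)=(I+dM,\,I+Md)\quad(M\in K_1),\qquad \Phi_{(B_0,B_1)}M=B_1MB_0^{-1}\quad((B_0,B_1)\in K_0,\ M\in K_1),$$ the quadruple $\mathrm{Aut}(\mathbb V)=(K_1,K_0,\int\delta,\Phi)$ is a crossed module of Lie groups: $\int\delta:K_1\to K_0$ is a smooth group morphism, $\Phi$ is a smooth action of $K_0$ on $K_1$ by group automorphisms, $(\int\delta)(\Phi_gM)=g\,(\int\delta)(M)\,g^{-1}$, and $\Phi_{(\int\delta)(M)}M'=M\cdot M'\cdot M^{-1}$. Finally, $\mathrm{Aut}(\mathbb V)$ differentiates to $\mathrm{End}(\mathbb V)$. That is, the differentials at the identity of the inclusions $K_1\subset\mathrm{Hom}(V_0,V_1)$ and $K_0\subset\mathfrak k_0$ identify the Lie algebras of $K_1$ and $K_0$ (tangent spaces at the identity with the bracket of left-invariant vector fields) with $\mathfrak k_1$ and $\mathfrak k_0$. Under these identifications the differential of $\int\delta$ at the identity is $\delta$, and the differential at the identity of the map $g\mapsto \mathrm d_0(\Phi_g)A$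 from $K_0$ to $\mathfrak k_1$ is $X\mapsto\phi_X(A)$, for every $A\in\mathfrak k_1$. -/

import Mathlib

open scoped Manifold ContDiff

noncomputable section

/-! ### Crossed modules of Lie algebras and of Lie groups -/

/-- `(L₁, L₀, dt, φ)` is a crossed module of (real) Lie algebras. -/
structure IsLieAlgebraCrossedModule {L₁ L₀ : Type*}
    [LieRing L₁] [LieAlgebra ℝ L₁] [LieRing L₀] [LieAlgebra ℝ L₀]
    (dt : L₁ →ₗ⁅ℝ⁆ L₀) (φ : L₀ →ₗ⁅ℝ⁆ LieDerivation ℝ L₁ L₁) : Prop where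
  equivariant : ∀ (X : L₀) (A : L₁), dt (φ X A) = ⁅X, dt A⁆
  peiffer : ∀ A B : L₁, φ (dt A) B = ⁅A, B⁆

/-- `(G₁, G₀, t, Φ)` is a crossed module of (real, smooth) Lie groups. -/
structure IsLieGroupCrossedModule
    {E₁ H₁ G₁ E₀ H₀ G₀ : Type*}
    [NormedAddCommGroup E₁] [NormedSpace ℝ E₁] [TopologicalSpace H₁]
    (I₁ : ModelWithCorners ℝ E₁ H₁) [TopologicalSpace G₁] [ChartedSpace H₁ G₁] [Group G₁]
    [NormedAddCommGroup E₀] [NormedSpace ℝ E₀] [TopologicalSpace H₀]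
    (I₀ : ModelWithCorners ℝ E₀ H₀) [TopologicalSpace G₀] [ChartedSpace H₀ G₀] [Group G₀]
    (t : G₁ →* G₀) (Φ : G₀ →* MulAut G₁) : Prop where
  lieGroup₁ : LieGroup I₁ ∞ G₁
  lieGroup₀ : LieGroup I₀ ∞ G₀
  smooth_t : ContMDiff I₁ I₀ ∞ t
  smooth_action : ContMDiff (I₀.prod I₁) I₁ ∞ (fun p : G₀ × G₁ => Φ p.1 p.2)
  equivariant : ∀ (g : G₀) (h : G₁), t (Φ g h) = g * t h * g⁻¹
  peiffer : ∀ h h' : G₁, Φ (t h) h' = h * h' * h⁻¹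

section Differentiation

variable {E₁ H₁ G₁ E₀ H₀ G₀ : Type*}
  [NormedAddCommGroup E₁] [NormedSpace ℝ E₁] [TopologicalSpace H₁]
  (I₁ : ModelWithCorners ℝ E₁ H₁) [TopologicalSpace G₁] [ChartedSpace H₁ G₁] [Group G₁]
  [NormedAddCommGroup E₀] [NormedSpace ℝ E₀] [TopologicalSpace H₀]
  (I₀ : ModelWithCorners ℝ E₀ H₀) [TopologicalSpace G₀] [ChartedSpace H₀ G₀] [Group G₀]

/-- The differential at the identity of a group morphism, as a map between the tangent spaces at
the identities. (`t 1 = 1`, and all tangent spaces are modelled on the same vector space.) -/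
def tangentMorphism (t : G₁ →* G₀) : GroupLieAlgebra I₁ G₁ →L[ℝ] GroupLieAlgebra I₀ G₀ :=
  (mfderiv I₁ I₀ t (1 : G₁) : E₁ →L[ℝ] E₀)

/-- For an action `Φ` of `G₀` on `G₁` by automorphisms, the action of `g : G₀` on the tangent
space of `G₁` at the identity: the differential of `Φ g` at the identity applied to `A`. -/
def tangentAction (Φ : G₀ →* MulAut G₁) (A : GroupLieAlgebra I₁ G₁) (g : G₀) : E₁ :=
  tangentMorphism I₁ I₁ (Φ g).toMonoidHom A

/-- The crossed module of Lie groups `(G₁, G₀, t, Φ)` differentiates to the crossed module of Lie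
algebras `(L₁, L₀, dt, φ)`, where the Lie algebras (tangent spaces at the identity with the bracket
of left invariant vector fields) of `G₁` and `G₀` are identified with `L₁` and `L₀` through the
linear isomorphisms `e₁` and `e₀`. -/
structure IsDifferentiation {L₁ L₀ : Type*}
    [LieRing L₁] [LieAlgebra ℝ L₁] [LieRing L₀] [LieAlgebra ℝ L₀]
    (t : G₁ →* G₀) (Φ : G₀ →* MulAut G₁)
    (dt : L₁ →ₗ⁅ℝ⁆ L₀) (φ : L₀ →ₗ⁅ℝ⁆ LieDerivation ℝ L₁ L₁)
    (e₁ : GroupLieAlgebra I₁ G₁ ≃ₗ[ℝ] L₁) (e₀ : GroupLieAlgebra I₀ G₀ ≃ₗ[ℝ] L₀) : Prop where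
  map_lie₁ : ∀ A B : GroupLieAlgebra I₁ G₁, e₁ ⁅A, B⁆ = ⁅e₁ A, e₁ B⁆
  map_lie₀ : ∀ X Y : GroupLieAlgebra I₀ G₀, e₀ ⁅X, Y⁆ = ⁅e₀ X, e₀ Y⁆
  deriv_t : ∀ A : GroupLieAlgebra I₁ G₁, e₀ (tangentMorphism I₁ I₀ t A) = dt (e₁ A)
  differentiable_action : ∀ A : GroupLieAlgebra I₁ G₁,
    MDifferentiableAt I₀ 𝓘(ℝ, E₁) (tangentAction I₁ Φ A) (1 : G₀)
  deriv_action : ∀ (X : GroupLieAlgebra I₀ G₀) (A : GroupLieAlgebra I₁ G₁),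
    e₁ (mfderiv I₀ 𝓘(ℝ, E₁) (tangentAction I₁ Φ A) (1 : G₀) X) = φ (e₀ X) (e₁ A)

end Differentiation

/-! ### The crossed modules attached to a two-term complex `d : V₁ → V₀` -/

namespace TwoTerm

variable {V₀ V₁ : Type*}
  [NormedAddCommGroup V₀] [NormedSpace ℝ V₀]
  [NormedAddCommGroup V₁] [NormedSpace ℝ V₁]
  (d : V₁ →L[ℝ] V₀)

/-- The pairs `(X₀, X₁)` in `End V₀ × End V₁` with `X₀ ∘ d = d ∘ X₁`; as a Lie algebra (with the
commutator bracket of this associative algebra) this is `𝔨₀`. -/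
def k₀ : Subalgebra ℝ ((V₀ →L[ℝ] V₀) × (V₁ →L[ℝ] V₁)) where
  carrier := {X | X.1 ∘L d = d ∘L X.2}
  mul_mem' {X Y} hX hY := by
    ext v
    have h1 := fun v => congrArg (fun f => f v) (show X.1 ∘L d = d ∘L X.2 from hX)
    have h2 := fun v => congrArg (fun f => f v) (show Y.1 ∘L d = d ∘L Y.2 from hY)
    simp only [ContinuousLinearMap.comp_apply] at h1 h2
    simp [h1, h2]
  add_mem' {X Y} hX hY := by
    ext v
    have h1 := congrArg (fun f => f v) (show X.1 ∘L d = d ∘L X.2 from hX)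
    have h2 := congrArg (fun f => f v) (show Y.1 ∘L d = d ∘L Y.2 from hY)
    simp only [ContinuousLinearMap.comp_apply] at h1 h2
    simp [h1, h2]
  algebraMap_mem' r := by
    ext v
    simp [Algebra.algebraMap_eq_smul_one]

/-- `[X, X'] = X X' - X' X`. -/
instance : LieRing (k₀ d) := LieRing.ofAssociativeRing

theorem k₀.comm (X : k₀ d) (v : V₁) : X.1.1 (d v) = d (X.1.2 v) :=
  congrArg (fun f => f v) (show X.1.1 ∘L d = d ∘L X.1.2 from X.2)

/-- The vector space `Hom(V₀, V₁)`, to be endowed with the bracket `[A, B] = A d B - B d A`. -/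
def k₁ (_d : V₁ →L[ℝ] V₀) : Type _ := V₀ →L[ℝ] V₁

instance : AddCommGroup (k₁ d) := inferInstanceAs (AddCommGroup (V₀ →L[ℝ] V₁))
instance : Module ℝ (k₁ d) := inferInstanceAs (Module ℝ (V₀ →L[ℝ] V₁))

/-- The identification of the vector spaces `𝔨₁` and `Hom(V₀, V₁)`. -/
def k₁.toHom : k₁ d ≃ₗ[ℝ] (V₀ →L[ℝ] V₁) := LinearEquiv.refl ℝ (V₀ →L[ℝ] V₁)

instance : Bracket (k₁ d) (k₁ d) where
  bracket A B := (k₁.toHom d).symm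
    (k₁.toHom d A ∘L d ∘L k₁.toHom d B - k₁.toHom d B ∘L d ∘L k₁.toHom d A)

theorem k₁.toHom_lie (A B : k₁ d) : k₁.toHom d ⁅A, B⁆ =
    k₁.toHom d A ∘L d ∘L k₁.toHom d B - k₁.toHom d B ∘L d ∘L k₁.toHom d A :=
  (k₁.toHom d).apply_symm_apply _

instance : LieRing (k₁ d) where
  add_lie A B C := by
    apply (k₁.toHom d).injective; ext v; simp [k₁.toHom_lie]; abel
  lie_add A B C := by
    apply (k₁.toHom d).injective; ext v; simp [k₁.toHom_lie]; abel
  lie_self A := by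
    apply (k₁.toHom d).injective; ext v; simp [k₁.toHom_lie]
  leibniz_lie A B C := by
    apply (k₁.toHom d).injective; ext v; simp [k₁.toHom_lie]; abel

instance : LieAlgebra ℝ (k₁ d) where
  lie_smul r A B := by
    apply (k₁.toHom d).injective; ext v; simp [k₁.toHom_lie, smul_sub]

/-- `δ(A) = (d A, A d)`. -/
def δ : k₁ d →ₗ⁅ℝ⁆ k₀ d where
  toFun A := ⟨(d ∘L k₁.toHom d A, k₁.toHom d A ∘L d), rfl⟩
  map_add' A B := by
    apply Subtype.ext; ext v <;> simp
  map_smul' r A := by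
    apply Subtype.ext; ext v <;> simp
  map_lie' {A B} := by
    apply Subtype.ext; ext v <;> simp [k₁.toHom_lie, LieRing.of_associative_ring_bracket]

/-- `φ_X(A) = [X, A] = X₁ A - A X₀` for `X = (X₀, X₁)`. -/
def φ : k₀ d →ₗ⁅ℝ⁆ LieDerivation ℝ (k₁ d) (k₁ d) where
  toFun X :=
    { toFun := fun A => (k₁.toHom d).symm
        (X.1.2 ∘L k₁.toHom d A - k₁.toHom d A ∘L X.1.1)
      map_add' := fun A B => by
        apply (k₁.toHom d).injective; ext v; simp; abel
      map_smul' := fun r A => by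
        apply (k₁.toHom d).injective; ext v; simp [smul_sub]
      leibniz' := fun A B => by
        have h := fun v => congrArg (fun f => f v) (show X.1.1 ∘L d = d ∘L X.1.2 from X.2)
        simp only [ContinuousLinearMap.comp_apply] at h
        apply (k₁.toHom d).injective; ext v; simp [k₁.toHom_lie, h]; abel }
  map_add' X Y := by
    ext A; apply (k₁.toHom d).injective; ext v; simp; abel
  map_smul' r X := by
    ext A; apply (k₁.toHom d).injective; ext v; simp [smul_sub]
  map_lie' {X Y} := by
    ext A; apply (k₁.toHom d).injective; ext v
    simp [LieRing.of_associative_ring_bracket]; abel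

variable [FiniteDimensional ℝ V₀] [FiniteDimensional ℝ V₁]

/-- The set of `M` in `Hom(V₀, V₁)` with `I + d M` and `I + M d` invertible, as an open subset
(hence an open submanifold) of `Hom(V₀, V₁)`. -/
def K₁ : TopologicalSpace.Opens (V₀ →L[ℝ] V₁) where
  carrier := {M | IsUnit (1 + d ∘L M) ∧ IsUnit (1 + M ∘L d)}
  is_open' := by
    have := FiniteDimensional.complete ℝ V₀
    have := FiniteDimensional.complete ℝ V₁
    refine (Units.isOpen.preimage (f := fun M : V₀ →L[ℝ] V₁ => 1 + d ∘L M) ?_).inter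
      (Units.isOpen.preimage (f := fun M : V₀ →L[ℝ] V₁ => 1 + M ∘L d) ?_) <;> fun_prop

/-- The set of pairs `(B₀, B₁)` with `B₀ ∘ d = d ∘ B₁` and `B₀`, `B₁` invertible, as an open subset
(hence an open submanifold) of the vector space of all pairs with `B₀ ∘ d = d ∘ B₁`. -/
def K₀ : TopologicalSpace.Opens (k₀ d) where
  carrier := {B | IsUnit B.1.1 ∧ IsUnit B.1.2}
  is_open' := by
    have := FiniteDimensional.complete ℝ V₀
    have := FiniteDimensional.complete ℝ V₁
    refine (Units.isOpen.preimage (f := fun B : k₀ d => B.1.1) ?_).inter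
      (Units.isOpen.preimage (f := fun B : k₀ d => B.1.2) ?_) <;> fun_prop

variable {d}

theorem unit_inv_comp_self {V : Type*} [NormedAddCommGroup V] [NormedSpace ℝ V]
    {f : V →L[ℝ] V} (hf : IsUnit f) (v : V) : (↑hf.unit⁻¹ : V →L[ℝ] V) (f v) = v :=
  congrArg (fun g => g v) hf.val_inv_mul

theorem self_comp_unit_inv {V : Type*} [NormedAddCommGroup V] [NormedSpace ℝ V]
    {f : V →L[ℝ] V} (hf : IsUnit f) (v : V) : f ((↑hf.unit⁻¹ : V →L[ℝ] V) v) = v :=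
  congrArg (fun g => g v) hf.mul_val_inv

theorem isUnit_of_inverse {V : Type*} [NormedAddCommGroup V] [NormedSpace ℝ V]
    {f g : V →L[ℝ] V} (h : ∀ v, f (g v) = v) (h' : ∀ v, g (f v) = v) : IsUnit f :=
  ⟨⟨f, g, ContinuousLinearMap.ext h, ContinuousLinearMap.ext h'⟩, rfl⟩

/-! #### The group `K₁` -/

/-- `M₁ · M₂ = M₁ + M₂ + M₁ d M₂`. -/
instance : Mul (K₁ d) where
  mul M N := ⟨M.1 + N.1 + M.1 ∘L d ∘L N.1, by
    have h1 := M.2.1.mul N.2.1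
    have h2 := M.2.2.mul N.2.2
    constructor
    · convert h1 using 1; ext v; simp; abel
    · convert h2 using 1; ext v; simp; abel⟩

instance : One (K₁ d) where
  one := ⟨0, by constructor <;> simp⟩

/-- `M⁻¹ = -(I + M d)⁻¹ M`. -/
instance : Inv (K₁ d) where
  inv M := ⟨-((↑(M.2.2.unit⁻¹) : V₁ →L[ℝ] V₁) ∘L M.1), by
    have h1 := unit_inv_comp_self M.2.2
    have h2 := self_comp_unit_inv M.2.2
    simp only [add_apply, one_apply_eq_self, ContinuousLinearMap.comp_apply,
      map_add] at h1 h2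
    constructor
    · refine isUnit_of_inverse (g := 1 + d ∘L M.1) (fun v => ?_) (fun v => ?_)
      · have h3 := congrArg d (h1 (M.1 v))
        rw [map_add] at h3
        simp only [add_apply, one_apply_eq_self, ContinuousLinearMap.comp_apply, neg_apply,
          map_add, map_neg]
        rw [← eq_sub_iff_add_eq] at h3
        rw [h3]
        abel
      · have h3 := congrArg d (h2 (M.1 v))
        rw [map_add] at h3
        simp only [add_apply, one_apply_eq_self, ContinuousLinearMap.comp_apply, neg_apply,
          map_add, map_neg, ← h3]
        abel
    · convert M.2.2.unit⁻¹.isUnit using 1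
      ext v
      simp only [add_apply, one_apply_eq_self, ContinuousLinearMap.comp_apply, neg_apply]
      rw [← sub_eq_add_neg, sub_eq_iff_eq_add]
      exact (h1 v).symm⟩

theorem K₁.coe_mul (M N : K₁ d) :
    (↑(M * N) : V₀ →L[ℝ] V₁) = M.1 + N.1 + M.1 ∘L d ∘L N.1 := rfl

theorem K₁.coe_one : (↑(1 : K₁ d) : V₀ →L[ℝ] V₁) = 0 := rfl

theorem K₁.coe_inv (M : K₁ d) :
    (↑(M⁻¹) : V₀ →L[ℝ] V₁) = -((↑(M.2.2.unit⁻¹) : V₁ →L[ℝ] V₁) ∘L M.1) := rfl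

instance : Group (K₁ d) :=
  Group.ofLeftAxioms
    (fun M N P => by
      apply Subtype.ext; ext v; simp [K₁.coe_mul]; abel)
    (fun M => by
      apply Subtype.ext; ext v; simp [K₁.coe_mul, K₁.coe_one])
    (fun M => by
      apply Subtype.ext; ext v
      have h1 := unit_inv_comp_self M.2.2 (M.1 v)
      simp only [add_apply, one_apply_eq_self, ContinuousLinearMap.comp_apply, map_add] at h1
      simp only [K₁.coe_mul, K₁.coe_one, K₁.coe_inv, add_apply, zero_apply,
        ContinuousLinearMap.comp_apply, neg_apply]
      rw [add_right_comm, ← neg_add, h1, neg_add_cancel])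

/-! #### The group `K₀` -/

/-- Componentwise composition. -/
instance : Mul (K₀ d) where
  mul B C := ⟨B.1 * C.1, B.2.1.mul C.2.1, B.2.2.mul C.2.2⟩

instance : One (K₀ d) where
  one := ⟨1, isUnit_one, isUnit_one⟩

/-- Componentwise inverse. -/
instance : Inv (K₀ d) where
  inv B := ⟨⟨(↑(B.2.1.unit⁻¹), ↑(B.2.2.unit⁻¹)), by
    have h := k₀.comm d B.1
    change _ ∘L d = d ∘L _
    ext v
    have h1 := unit_inv_comp_self B.2.1 (d ((↑(B.2.2.unit⁻¹) : V₁ →L[ℝ] V₁) v))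
    rw [h, self_comp_unit_inv B.2.2] at h1
    exact h1⟩, B.2.1.unit⁻¹.isUnit, B.2.2.unit⁻¹.isUnit⟩

theorem K₀.self_inv_fst (B : K₀ d) (v : V₀) : B.1.1.1 ((B⁻¹).1.1.1 v) = v :=
  self_comp_unit_inv B.2.1 v

theorem K₀.self_inv_snd (B : K₀ d) (v : V₁) : B.1.1.2 ((B⁻¹).1.1.2 v) = v :=
  self_comp_unit_inv B.2.2 v

theorem K₀.inv_self_fst (B : K₀ d) (v : V₀) : (B⁻¹).1.1.1 (B.1.1.1 v) = v :=
  unit_inv_comp_self B.2.1 v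

theorem K₀.inv_self_snd (B : K₀ d) (v : V₁) : (B⁻¹).1.1.2 (B.1.1.2 v) = v :=
  unit_inv_comp_self B.2.2 v

instance : Group (K₀ d) :=
  Group.ofLeftAxioms
    (fun B C D => Subtype.ext (mul_assoc B.1 C.1 D.1))
    (fun B => Subtype.ext (one_mul B.1))
    (fun B => Subtype.ext (Subtype.ext (Prod.ext
      (ContinuousLinearMap.ext (K₀.inv_self_fst B)) (ContinuousLinearMap.ext (K₀.inv_self_snd B)))))

/-! #### The morphism and the action -/

variable (d)

/-- `(∫δ)(M) = (I + d M, I + M d)`. -/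
def intδ : K₁ d →* K₀ d where
  toFun M := ⟨⟨(1 + d ∘L M.1, 1 + M.1 ∘L d), by
    change _ ∘L d = d ∘L _
    ext v; simp⟩, M.2⟩
  map_one' := by
    apply Subtype.ext; apply Subtype.ext
    refine Prod.ext ?_ ?_
    · change 1 + d ∘L 0 = (1 : V₀ →L[ℝ] V₀); simp
    · change 1 + 0 ∘L d = (1 : V₁ →L[ℝ] V₁); simp
  map_mul' M N := by
    apply Subtype.ext; apply Subtype.ext
    refine Prod.ext ?_ ?_
    · change 1 + d ∘L (M.1 + N.1 + M.1 ∘L d ∘L N.1) = (1 + d ∘L M.1) * (1 + d ∘L N.1)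
      ext v; simp; abel
    · change 1 + (M.1 + N.1 + M.1 ∘L d ∘L N.1) ∘L d = (1 + M.1 ∘L d) * (1 + N.1 ∘L d)
      ext v; simp; abel

/-- `B₁ M B₀⁻¹` for `B = (B₀, B₁)` in `K₀` and `M` in `K₁`. -/
def conj (B : K₀ d) (M : K₁ d) : K₁ d :=
  ⟨B.1.1.2 ∘L M.1 ∘L (B⁻¹).1.1.1, by
    have h := k₀.comm d B.1
    have h' := k₀.comm d (B⁻¹).1
    constructor
    · convert (B.2.1.mul M.2.1).mul (B⁻¹).2.1 using 1
      ext v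
      simp [← h, K₀.self_inv_fst]
    · convert (B.2.2.mul M.2.2).mul (B⁻¹).2.2 using 1
      ext v
      simp [h', K₀.self_inv_snd]⟩

theorem conj_apply (B : K₀ d) (M : K₁ d) (v : V₀) :
    (conj d B M).1 v = B.1.1.2 (M.1 ((B⁻¹).1.1.1 v)) := rfl

/-- The action of `K₀` on `K₁` by `Φ_{(B₀, B₁)} M = B₁ M B₀⁻¹`. -/
def Φ : K₀ d →* MulAut (K₁ d) where
  toFun B :=
    { toFun := conj d B
      invFun := conj d B⁻¹
      left_inv := fun M => by
        apply Subtype.ext; ext v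
        simp [conj_apply, K₀.inv_self_fst, K₀.inv_self_snd]
      right_inv := fun M => by
        apply Subtype.ext; ext v
        simp only [conj_apply, inv_inv, K₀.self_inv_fst, K₀.self_inv_snd]
      map_mul' := fun M N => by
        apply Subtype.ext; ext v
        simp [conj_apply, K₁.coe_mul, ← k₀.comm, K₀.inv_self_fst] }
  map_one' := by
    refine MulEquiv.ext fun M => Subtype.ext (ContinuousLinearMap.ext fun v => ?_)
    change (conj d 1 M).1 v = M.1 v
    rw [conj_apply, inv_one]; rfl
  map_mul' B C := by
    refine MulEquiv.ext fun M => Subtype.ext (ContinuousLinearMap.ext fun v => ?_)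
    change (conj d (B * C) M).1 v = (conj d B (conj d C M)).1 v
    rw [conj_apply, mul_inv_rev]; rfl

end TwoTerm

end

open scoped Topology

/-! ### Calculus and Lie brackets on open subsets of normed spaces. -/

namespace TopologicalSpace.Opens

variable {E F : Type*} [NormedAddCommGroup E] [NormedSpace ℝ E]
  [NormedAddCommGroup F] [NormedSpace ℝ F]

/-! Both groups are open subsets of vector spaces, and the inclusion has the identity as
differential, so every manifold statement becomes Fréchet calculus of an ambient formula. For two
left-invariant fields with ambient expressions `V` and `W`, the bracket at the identity is `W' V -
V' W` (`groupLieAlgebra_bracket`).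

`K₀` is an open group in the associative algebra `k₀`. Its inversion is `Ring.inverse`, smooth near
units, and its left-invariant fields `g ↦ g v` are linear, which gives the commutator. In `K₁` left
translation by `M` is affine with linear part `A ↦ A + M d A`; these fields are affine in `M` and
their bracket at `0` is `A d B - B d A`. Inversion is smooth because `I + M d` is a unit.

The map `∫δ` is `1 + δ`, hence affine with linear part `δ`. Each `Φ_B` is the restriction of a
linear map, so it is its own differential, and differentiating `B₁ A B₀⁻¹` at the identity gives `X₁
A - A X₀`. The crossed module axioms are algebraic: `B₀ d = d B₁` gives equivariance, and cancelling
`(I + d M)⁻¹` gives the Peiffer identity. -/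

theorem hasMFDerivAt_val (U : Opens E) (x : U) :
    HasMFDerivAt 𝓘(ℝ, E) 𝓘(ℝ, E) (Subtype.val : U → E) x (ContinuousLinearMap.id ℝ E) := by
  refine ⟨continuous_subtype_val.continuousAt, ?_⟩
  have h : writtenInExtChartAt 𝓘(ℝ, E) 𝓘(ℝ, E) x (Subtype.val : U → E) =ᶠ[𝓝 x.1] id := by
    filter_upwards [U.chartAt_subtype_val_symm_eventuallyEq (H := E) (x := x)] with y hy
    exact hy.symm
  exact ((hasFDerivAt_id x.1).congr_of_eventuallyEq h).hasFDerivWithinAt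

theorem mfderiv_val (U : Opens E) (x : U) :
    mfderiv 𝓘(ℝ, E) 𝓘(ℝ, E) (Subtype.val : U → E) x = ContinuousLinearMap.id ℝ E :=
  (U.hasMFDerivAt_val x).mfderiv

/-- Chain rule through the inclusion: any ambient extension `g` computes the differential of `f`. -/
theorem hasMFDerivAt_of_comp_val {U : Opens E} {x : U} {f : U → F} {g : E → F} {g' : E →L[ℝ] F}
    (hg : HasFDerivAt g g' x.1) (h : ∀ y : U, f y = g y.1) :
    HasMFDerivAt 𝓘(ℝ, E) 𝓘(ℝ, F) f x g' := by
  obtain rfl : f = g ∘ Subtype.val := funext h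
  exact hg.hasMFDerivAt.comp x (U.hasMFDerivAt_val x)

theorem contMDiff_of_comp_val {U : Opens E} {f : U → F} {g : E → F} {n : ℕ∞ω}
    (hg : ∀ x : U, ContDiffAt ℝ n g x.1) (h : ∀ y : U, f y = g y.1) :
    ContMDiff 𝓘(ℝ, E) 𝓘(ℝ, F) n f := by
  obtain rfl : f = g ∘ Subtype.val := funext h
  exact fun x => (hg x).contMDiffAt.comp x contMDiff_subtype_val.contMDiffAt

/-- Composing with the inclusion does not change the differential, so a map into an open set can be
differentiated in the ambient space. -/
theorem mfderiv_eq_of_val_comp {M H E' : Type*} [NormedAddCommGroup E'] [NormedSpace ℝ E']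
    [TopologicalSpace H] {I : ModelWithCorners ℝ E' H} [TopologicalSpace M] [ChartedSpace H M]
    {V : Opens F} {x : M} {f : M → V} {g' : E' →L[ℝ] F}
    (hf : MDifferentiableAt I 𝓘(ℝ, F) f x)
    (hg : HasMFDerivAt I 𝓘(ℝ, F) (Subtype.val ∘ f) x g') :
    mfderiv I 𝓘(ℝ, F) f x = g' := by
  have h := hasMFDerivAt_unique ((V.hasMFDerivAt_val (f x)).comp x hf.hasMFDerivAt) hg
  exact ContinuousLinearMap.ext fun v => DFunLike.congr_fun h v

theorem contMDiff_of_val_comp {M H E' : Type*} [NormedAddCommGroup E'] [NormedSpace ℝ E']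
    [TopologicalSpace H] {I : ModelWithCorners ℝ E' H} [TopologicalSpace M] [ChartedSpace H M]
    {V : Opens F} {f : M → V} (h : ContMDiff I 𝓘(ℝ, F) ∞ fun x => (f x).1) :
    ContMDiff I 𝓘(ℝ, F) ∞ f :=
  (ContMDiff.subtypeVal_comp_iff V f).1 h

open VectorField in
/-- The bracket on the Lie algebra of an open submanifold `U` of a normed space with a group
structure, in terms of the expressions of left invariant vector fields on the ambient space. -/
theorem groupLieAlgebra_bracket [CompleteSpace E] {U : Opens E} [Group U]
    {v w : GroupLieAlgebra 𝓘(ℝ, E) U} {V W : E → E} {V' W' : E →L[ℝ] E}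
    (hV : HasFDerivAt V V' (1 : U).1) (hW : HasFDerivAt W W' (1 : U).1)
    (hv : ∀ g : U, mulInvariantVectorField v g = V g.1)
    (hw : ∀ g : U, mulInvariantVectorField w g = W g.1) :
    (⁅v, w⁆ : GroupLieAlgebra 𝓘(ℝ, E) U) = (W' (V (1 : U).1) - V' (W (1 : U).1) : E) := by
  -- Pulling a field back along the inclusion only restricts it. The left-invariant fields are
  -- therefore pullbacks of `V` and `W`, and naturality of the bracket moves the computation to `E`.
  have key : ∀ (X : (x : E) → TangentSpace 𝓘(ℝ, E) x) (g : U),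
      mpullback 𝓘(ℝ, E) 𝓘(ℝ, E) (Subtype.val : U → E) X g = X g.1 := by
    intro X g
    rw [mpullback_apply, mfderiv_val]
    exact congrArg (fun f : E →L[ℝ] E => f (X g.1)) ContinuousLinearMap.inverse_id
  have hv' : (mulInvariantVectorField v : (g : U) → TangentSpace 𝓘(ℝ, E) g) =
      mpullback 𝓘(ℝ, E) 𝓘(ℝ, E) (Subtype.val : U → E) V :=
    funext fun g => (hv g).trans (key V g).symm
  have hw' : (mulInvariantVectorField w : (g : U) → TangentSpace 𝓘(ℝ, E) g) =
      mpullback 𝓘(ℝ, E) 𝓘(ℝ, E) (Subtype.val : U → E) W :=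
    funext fun g => (hw g).trans (key W g).symm
  have hd : ∀ {X : E → E} {X' : E →L[ℝ] E}, HasFDerivAt X X' (1 : U).1 →
      MDifferentiableAt 𝓘(ℝ, E) 𝓘(ℝ, E).tangent
        (fun x => (⟨x, X x⟩ : TangentBundle 𝓘(ℝ, E) E)) (1 : U).1 := by
    intro X X' h
    rw [mdifferentiableAt_totalSpace]
    refine ⟨mdifferentiableAt_id, ?_⟩
    simpa using h.differentiableAt.mdifferentiableAt
  have hb : ∀ X Y : (x : E) → TangentSpace 𝓘(ℝ, E) x,
      mlieBracket 𝓘(ℝ, E) X Y (1 : U).1 = lieBracket ℝ X Y (1 : U).1 := by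
    intro X Y
    rw [← mlieBracketWithin_univ, mlieBracketWithin_eq_lieBracketWithin]
    exact congrFun (lieBracketWithin_univ (V := (X : E → E)) (W := (Y : E → E))) _
  rw [GroupLieAlgebra.bracket_def, hv', hw', ← mpullback_mlieBracket (n := ∞) (hd hV) (hd hW)
    contMDiff_subtype_val.contMDiffAt (by simpa using ENat.LEInfty.out), key]
  exact (hb V W).trans (by rw [lieBracket, hV.fderiv, hW.fderiv])

/-! #### Maps that are affine in the ambient coordinates -/

section Affine

variable [FiniteDimensional ℝ E]

theorem contMDiff_of_linear {U : Opens E} {f : U → F} (L : E →ₗ[ℝ] F) (h : ∀ y : U, f y = L y.1) :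
    ContMDiff 𝓘(ℝ, E) 𝓘(ℝ, F) ∞ f :=
  contMDiff_of_comp_val (fun _ => L.toContinuousLinearMap.contDiff.contDiffAt) h

variable {U : Opens E} {V : Opens F} {f : U → V} {b : F}

theorem contMDiff_of_affine (L : E →ₗ[ℝ] F) (h : ∀ y : U, (f y).1 = b + L y.1) :
    ContMDiff 𝓘(ℝ, E) 𝓘(ℝ, F) ∞ f :=
  contMDiff_of_val_comp <| contMDiff_of_comp_val
    (fun _ => (contDiff_const.add L.toContinuousLinearMap.contDiff).contDiffAt) h

/-- Applies to left translations in both groups, to `∫δ` and to each `Φ_B`; this is where all their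
differentials come from. -/
theorem mfderiv_of_affine (L : E →ₗ[ℝ] F) (h : ∀ y : U, (f y).1 = b + L y.1) (x : U) (v : E) :
    (mfderiv 𝓘(ℝ, E) 𝓘(ℝ, F) f x : E →L[ℝ] F) v = L v :=
  DFunLike.congr_fun (mfderiv_eq_of_val_comp
    ((contMDiff_of_affine L h).mdifferentiable (by simp) x)
    (hasMFDerivAt_of_comp_val (L.toContinuousLinearMap.hasFDerivAt.const_add b) h)) v

theorem tangentMorphism_of_affine [Group U] [Group V] (t : U →* V) (L : E →ₗ[ℝ] F)
    (h : ∀ y : U, (t y).1 = b + L y.1) (v : E) :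
    tangentMorphism 𝓘(ℝ, E) 𝓘(ℝ, F) t v = L v :=
  mfderiv_of_affine L h 1 v

end Affine

/-! #### Open groups of units -/

section Units

variable {R : Type*} [NormedRing R] {U : Opens R} [Group U]

/-- Elements of `U` are units of `R`, so inversion in `U` has an ambient extension that is smooth
near `U`. -/
theorem coe_inv_eq_ringInverse (hone : (1 : U).1 = 1) (hmul : ∀ a b : U, (a * b).1 = a.1 * b.1)
    (a : U) : (a⁻¹).1 = Ring.inverse a.1 :=
  (Ring.inverse_unit ⟨a.1, (a⁻¹).1, by rw [← hmul, mul_inv_cancel, hone],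
    by rw [← hmul, inv_mul_cancel, hone]⟩).symm

variable [NormedAlgebra ℝ R] [FiniteDimensional ℝ R]

theorem contDiffAt_ringInverse_coe (hone : (1 : U).1 = 1)
    (hmul : ∀ a b : U, (a * b).1 = a.1 * b.1) (a : U) :
    ContDiffAt ℝ ∞ (Ring.inverse : R → R) a.1 :=
  have := FiniteDimensional.complete ℝ R
  contDiffAt_ringInverse ℝ (⟨a.1, (a⁻¹).1, by rw [← hmul, mul_inv_cancel, hone],
    by rw [← hmul, inv_mul_cancel, hone]⟩ : Rˣ)

theorem lieGroup_of_units (hone : (1 : U).1 = 1) (hmul : ∀ a b : U, (a * b).1 = a.1 * b.1) :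
    LieGroup 𝓘(ℝ, R) ∞ U where
  contMDiff_mul := by
    apply contMDiff_of_val_comp
    have h : ContMDiff (𝓘(ℝ, R).prod 𝓘(ℝ, R)) 𝓘(ℝ, R × R) ∞ fun p : U × U => (p.1.1, p.2.1) :=
      (contMDiff_subtype_val.comp contMDiff_fst).prodMk_space
        (contMDiff_subtype_val.comp contMDiff_snd)
    simp_rw [hmul]
    exact (contDiff_fst.mul contDiff_snd : ContDiff ℝ ∞ fun p : R × R => p.1 * p.2).contMDiff.comp h
  contMDiff_inv := contMDiff_of_val_comp <|
    contMDiff_of_comp_val (contDiffAt_ringInverse_coe hone hmul) (coe_inv_eq_ringInverse hone hmul)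

theorem groupLieAlgebra_bracket_of_units (hone : (1 : U).1 = 1)
    (hmul : ∀ a b : U, (a * b).1 = a.1 * b.1) (v w : R) :
    @Bracket.bracket (GroupLieAlgebra 𝓘(ℝ, R) U) (GroupLieAlgebra 𝓘(ℝ, R) U) _ v w =
      (v * w - w * v : R) := by
  have := FiniteDimensional.complete ℝ R
  have h (x : R) : HasFDerivAt (fun y : R => y * x)
      ((ContinuousLinearMap.mul ℝ R).flip x) (1 : U).1 :=
    ((ContinuousLinearMap.mul ℝ R).flip x).hasFDerivAt
  have h' (u : R) (g : U) :
      mulInvariantVectorField (I := 𝓘(ℝ, R)) (u : GroupLieAlgebra 𝓘(ℝ, R) U) g = g.1 * u :=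
    mfderiv_of_affine (f := (g * ·)) (b := 0) (LinearMap.mulLeft ℝ g.1)
      (fun y => by simp [hmul]) 1 u
  refine (groupLieAlgebra_bracket (h v) (h w) (h' v) (h' w)).trans ?_
  simp [hone]
  rfl

/-- The derivative at the identity of `a ↦ S a ∘ A ∘ P a⁻¹`. -/
theorem hasMFDerivAt_conj {V W : Type*} [NormedAddCommGroup V] [NormedSpace ℝ V]
    [NormedAddCommGroup W] [NormedSpace ℝ W] (hone : (1 : U).1 = 1)
    (hmul : ∀ a b : U, (a * b).1 = a.1 * b.1)
    (P : R →ₐ[ℝ] V →L[ℝ] V) (S : R →ₐ[ℝ] W →L[ℝ] W)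
    (A : V →L[ℝ] W) {f : U → V →L[ℝ] W}
    (hf : ∀ a : U, f a = S a.1 ∘L A ∘L P (a⁻¹).1) :
    HasMFDerivAt 𝓘(ℝ, R) 𝓘(ℝ, V →L[ℝ] W) f 1
      ((ContinuousLinearMap.compL ℝ V W W).flip A ∘L S.toLinearMap.toContinuousLinearMap -
        ContinuousLinearMap.compL ℝ V V W A ∘L P.toLinearMap.toContinuousLinearMap) := by
  have := FiniteDimensional.complete ℝ R
  -- Inversion has derivative `X ↦ -X` at `1`, the source of the minus sign.
  have h1 : HasFDerivAt (fun a => P (Ring.inverse a)) (-P.toLinearMap.toContinuousLinearMap)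
      (1 : R) := by
    refine (P.toLinearMap.toContinuousLinearMap.hasFDerivAt.comp (1 : R)
      (hasFDerivAt_ringInverse (𝕜 := ℝ) (1 : Rˣ))).congr_fderiv ?_
    ext1 X
    simp
  have h2 := S.toLinearMap.toContinuousLinearMap.hasFDerivAt.clm_comp
    ((hasFDerivAt_const A (1 : R)).clm_comp h1)
  rw [← hone] at h2
  simp_rw [coe_inv_eq_ringInverse hone hmul] at hf
  refine (hasMFDerivAt_of_comp_val h2 hf).congr_mfderiv ?_
  ext X v
  simp [hone]
  abel

theorem mdifferentiableAt_conj {V W : Type*} [NormedAddCommGroup V] [NormedSpace ℝ V]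
    [NormedAddCommGroup W] [NormedSpace ℝ W] (hone : (1 : U).1 = 1)
    (hmul : ∀ a b : U, (a * b).1 = a.1 * b.1)
    (P : R →ₐ[ℝ] V →L[ℝ] V) (S : R →ₐ[ℝ] W →L[ℝ] W)
    (A : V →L[ℝ] W) {f : U → V →L[ℝ] W}
    (hf : ∀ a : U, f a = S a.1 ∘L A ∘L P (a⁻¹).1) :
    MDifferentiableAt 𝓘(ℝ, R) 𝓘(ℝ, V →L[ℝ] W) f 1 :=
  (hasMFDerivAt_conj hone hmul P S A hf).mdifferentiableAt

theorem mfderiv_conj {V W : Type*} [NormedAddCommGroup V] [NormedSpace ℝ V]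
    [NormedAddCommGroup W] [NormedSpace ℝ W] (hone : (1 : U).1 = 1)
    (hmul : ∀ a b : U, (a * b).1 = a.1 * b.1)
    (P : R →ₐ[ℝ] V →L[ℝ] V) (S : R →ₐ[ℝ] W →L[ℝ] W)
    (A : V →L[ℝ] W) {f : U → V →L[ℝ] W}
    (hf : ∀ a : U, f a = S a.1 ∘L A ∘L P (a⁻¹).1) (X : R) :
    (mfderiv 𝓘(ℝ, R) 𝓘(ℝ, V →L[ℝ] W) f 1 : R →L[ℝ] V →L[ℝ] W) X = S X ∘L A - A ∘L P X :=
  DFunLike.congr_fun (hasMFDerivAt_conj hone hmul P S A hf).mfderiv X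

end Units

end TopologicalSpace.Opens

/-! ### The two-term complex. -/

namespace TwoTerm
open TopologicalSpace.Opens

variable {V₀ V₁ : Type*}
  [NormedAddCommGroup V₀] [NormedSpace ℝ V₀] [NormedAddCommGroup V₁] [NormedSpace ℝ V₁]

/-- `(End V, δ, φ)` is a crossed module of Lie algebras. -/
theorem isLieAlgebraCrossedModule (d : V₁ →L[ℝ] V₀) :
    IsLieAlgebraCrossedModule (δ d) (φ d) where
  equivariant X A := by
    have h := k₀.comm d X
    apply Subtype.ext
    ext v <;> simp [δ, φ, LieRing.of_associative_ring_bracket, h]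
  peiffer A B := by
    apply (k₁.toHom d).injective
    ext v
    simp [δ, φ, k₁.toHom_lie]

variable [FiniteDimensional ℝ V₀] [FiniteDimensional ℝ V₁] {d : V₁ →L[ℝ] V₀}

/-! #### The Lie group `K₁` -/

theorem K₁.coe_inv_eq_ringInverse (M : K₁ d) :
    (↑(M⁻¹) : V₀ →L[ℝ] V₁) = -(Ring.inverse (1 + M.1 ∘L d) ∘L M.1) := by
  rw [K₁.coe_inv, Ring.inverse_of_isUnit M.2.2]

theorem K₁.coe_inv' (M : K₁ d) (h₀ : IsUnit (1 + d ∘L M.1)) :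
    (↑(M⁻¹) : V₀ →L[ℝ] V₁) = -(M.1 ∘L (↑(h₀.unit⁻¹) : V₀ →L[ℝ] V₀)) := by
  rw [K₁.coe_inv, neg_inj]
  ext v
  -- The reason is `(I + M d) M = M (I + d M)`, evaluated at `(I + d M)⁻¹ v`.
  have h := unit_inv_comp_self M.2.2 (M.1 ((↑(h₀.unit⁻¹) : V₀ →L[ℝ] V₀) v))
  have h' := self_comp_unit_inv h₀ v
  simp only [add_apply, one_apply_eq_self, ContinuousLinearMap.comp_apply] at h h' ⊢
  rw [← map_add M.1, h'] at h
  exact h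

instance K₁.lieGroup : LieGroup 𝓘(ℝ, V₀ →L[ℝ] V₁) ∞ (K₁ d) where
  contMDiff_mul := by
    apply contMDiff_of_val_comp
    have h : ContDiff ℝ ∞ fun p : (V₀ →L[ℝ] V₁) × (V₀ →L[ℝ] V₁) =>
        p.1 + p.2 + p.1 ∘L d ∘L p.2 := by fun_prop
    have h1 : ContMDiff (𝓘(ℝ, V₀ →L[ℝ] V₁).prod 𝓘(ℝ, V₀ →L[ℝ] V₁))
        𝓘(ℝ, (V₀ →L[ℝ] V₁) × (V₀ →L[ℝ] V₁)) ∞ fun p : K₁ d × K₁ d => (p.1.1, p.2.1) :=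
      (contMDiff_subtype_val.comp contMDiff_fst).prodMk_space
        (contMDiff_subtype_val.comp contMDiff_snd)
    exact h.contMDiff.comp h1
  contMDiff_inv := by
    have := FiniteDimensional.complete ℝ V₁
    apply contMDiff_of_val_comp
    refine contMDiff_of_comp_val (g := fun N : V₀ →L[ℝ] V₁ => -(Ring.inverse (1 + N ∘L d) ∘L N))
      (fun M => ?_) K₁.coe_inv_eq_ringInverse
    have h0 : ContDiff ℝ ∞ fun N : V₀ →L[ℝ] V₁ => 1 + N ∘L d := by fun_prop
    have h : ContDiffAt ℝ ∞ (fun N : V₀ →L[ℝ] V₁ => Ring.inverse (1 + N ∘L d)) M.1 :=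
      ContDiffAt.comp (g := Ring.inverse) M.1 (contDiffAt_ringInverse ℝ M.2.2.unit) h0.contDiffAt
    exact (h.clm_comp contDiffAt_id).neg

theorem K₁.mulInvariantVectorField_eq (A : V₀ →L[ℝ] V₁) (M : K₁ d) :
    mulInvariantVectorField (I := 𝓘(ℝ, V₀ →L[ℝ] V₁))
      (A : GroupLieAlgebra 𝓘(ℝ, V₀ →L[ℝ] V₁) (K₁ d)) M = A + M.1 ∘L d ∘L A := by
  exact mfderiv_of_affine (f := (M * · : K₁ d → K₁ d)) (b := M.1)
    (LinearMap.id + (ContinuousLinearMap.compL ℝ V₀ V₁ V₁ (M.1 ∘L d)).toLinearMap)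
    (fun N => add_assoc _ _ _) 1 A

theorem K₁.groupLieAlgebra_bracket_eq (A B : V₀ →L[ℝ] V₁) :
    @Bracket.bracket (GroupLieAlgebra 𝓘(ℝ, V₀ →L[ℝ] V₁) (K₁ d))
      (GroupLieAlgebra 𝓘(ℝ, V₀ →L[ℝ] V₁) (K₁ d)) _ A B =
      (A ∘L d ∘L B - B ∘L d ∘L A : V₀ →L[ℝ] V₁) := by
  have := FiniteDimensional.complete ℝ V₁
  have h (C : V₀ →L[ℝ] V₁) : HasFDerivAt (fun M : V₀ →L[ℝ] V₁ => C + M ∘L d ∘L C)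
      ((ContinuousLinearMap.compL ℝ V₀ V₀ V₁).flip (d ∘L C)) (1 : K₁ d).1 :=
    ((ContinuousLinearMap.compL ℝ V₀ V₀ V₁).flip (d ∘L C)).hasFDerivAt.const_add C
  refine (groupLieAlgebra_bracket (h A) (h B) (K₁.mulInvariantVectorField_eq A)
    (K₁.mulInvariantVectorField_eq B)).trans ?_
  simp [K₁.coe_one]
  rfl

/-! #### The Lie group `K₀` -/

instance : FiniteDimensional ℝ (k₀ d) :=
  FiniteDimensional.finiteDimensional_submodule (Subalgebra.toSubmodule (k₀ d))

instance K₀.lieGroup : LieGroup 𝓘(ℝ, k₀ d) ∞ (K₀ d) :=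
  lieGroup_of_units rfl fun _ _ => rfl

theorem K₀.groupLieAlgebra_bracket_eq (X Y : k₀ d) :
    @Bracket.bracket (GroupLieAlgebra 𝓘(ℝ, k₀ d) (K₀ d))
      (GroupLieAlgebra 𝓘(ℝ, k₀ d) (K₀ d)) _ X Y = (X * Y - Y * X : k₀ d) :=
  groupLieAlgebra_bracket_of_units rfl (fun _ _ => rfl) X Y

/-! #### The morphism -/

variable (d) in
/-- `δ` as a linear map on `Hom(V₀, V₁)`. -/
noncomputable def δHom : (V₀ →L[ℝ] V₁) →ₗ[ℝ] k₀ d :=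
  (δ d : k₁ d →ₗ[ℝ] k₀ d) ∘ₗ (k₁.toHom d).symm.toLinearMap

theorem coe_intδ (M : K₁ d) : (intδ d M).1 = 1 + δHom d M.1 := rfl

theorem contMDiff_intδ : ContMDiff 𝓘(ℝ, V₀ →L[ℝ] V₁) 𝓘(ℝ, k₀ d) ∞ (intδ d) :=
  contMDiff_of_affine (δHom d) coe_intδ

theorem tangentMorphism_intδ (A : V₀ →L[ℝ] V₁) :
    tangentMorphism 𝓘(ℝ, V₀ →L[ℝ] V₁) 𝓘(ℝ, k₀ d) (intδ d) A = δHom d A := by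
  have h := tangentMorphism_of_affine (intδ d) (δHom d) coe_intδ A
  exact h

/-! #### The action -/

variable (d) in
/-- The projection `(X₀, X₁) ↦ X₀`. -/
noncomputable def k₀.fst : k₀ d →ₐ[ℝ] V₀ →L[ℝ] V₀ :=
  (AlgHom.fst ℝ (V₀ →L[ℝ] V₀) (V₁ →L[ℝ] V₁)).comp (k₀ d).val

variable (d) in
/-- The projection `(X₀, X₁) ↦ X₁`. -/
noncomputable def k₀.snd : k₀ d →ₐ[ℝ] V₁ →L[ℝ] V₁ :=
  (AlgHom.snd ℝ (V₀ →L[ℝ] V₀) (V₁ →L[ℝ] V₁)).comp (k₀ d).val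

/-- Puts the action in the form `S(B) M P(B⁻¹)`, with `S` and `P` algebra morphisms, that
`hasMFDerivAt_conj` differentiates. -/
theorem coe_Φ (B : K₀ d) (M : K₁ d) :
    (Φ d B M).1 = k₀.snd d B.1 ∘L M.1 ∘L k₀.fst d (B⁻¹).1 := rfl

theorem contMDiff_Φ : ContMDiff (𝓘(ℝ, k₀ d).prod 𝓘(ℝ, V₀ →L[ℝ] V₁)) 𝓘(ℝ, V₀ →L[ℝ] V₁) ∞
    fun p : K₀ d × K₁ d => Φ d p.1 p.2 := by
  apply contMDiff_of_val_comp
  have hS : ContMDiff 𝓘(ℝ, k₀ d) 𝓘(ℝ, V₁ →L[ℝ] V₁) ∞ fun B : K₀ d => k₀.snd d B.1 :=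
    contMDiff_of_linear (k₀.snd d).toLinearMap fun _ => rfl
  have hP : ContMDiff 𝓘(ℝ, k₀ d) 𝓘(ℝ, V₀ →L[ℝ] V₀) ∞ fun B : K₀ d => k₀.fst d B.1 :=
    contMDiff_of_linear (k₀.fst d).toLinearMap fun _ => rfl
  have hM : ContMDiff (𝓘(ℝ, k₀ d).prod 𝓘(ℝ, V₀ →L[ℝ] V₁)) 𝓘(ℝ, V₀ →L[ℝ] V₁) ∞
      fun p : K₀ d × K₁ d => p.2.1 := contMDiff_subtype_val.comp contMDiff_snd
  exact (hS.comp contMDiff_fst).clm_comp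
    (hM.clm_comp ((hP.comp (contMDiff_inv 𝓘(ℝ, k₀ d) ∞)).comp contMDiff_fst))

theorem tangentAction_Φ (A : V₀ →L[ℝ] V₁) (B : K₀ d) :
    tangentAction 𝓘(ℝ, V₀ →L[ℝ] V₁) (Φ d) A B =
      k₀.snd d B.1 ∘L A ∘L k₀.fst d (B⁻¹).1 :=
  mfderiv_of_affine (f := Φ d B) (b := 0)
    (ContinuousLinearMap.compL ℝ V₀ V₁ V₁ (k₀.snd d B.1) ∘L
      (ContinuousLinearMap.compL ℝ V₀ V₀ V₁).flip (k₀.fst d (B⁻¹).1)).toLinearMap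
    (fun M => (coe_Φ B M).trans (zero_add _).symm) 1 A

/-! #### The crossed module of Lie groups and its differentiation -/

variable (d)

/-- `(Aut V, ∫δ, Φ)` is a crossed module of Lie groups. -/
theorem isLieGroupCrossedModule :
    IsLieGroupCrossedModule 𝓘(ℝ, V₀ →L[ℝ] V₁) 𝓘(ℝ, k₀ d) (intδ d) (Φ d) where
  lieGroup₁ := inferInstance
  lieGroup₀ := inferInstance
  smooth_t := contMDiff_intδ
  smooth_action := contMDiff_Φ
  equivariant B M := by
    rw [eq_mul_inv_iff_mul_eq]
    apply Subtype.ext; apply Subtype.ext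
    have h := k₀.comm d B.1
    refine Prod.ext ?_ ?_
    · change (1 + d ∘L (conj d B M).1) * B.1.1.1 = B.1.1.1 * (1 + d ∘L M.1)
      ext v
      simp [conj_apply, K₀.inv_self_fst, h]
    · change (1 + (conj d B M).1 ∘L d) * B.1.1.2 = B.1.1.2 * (1 + M.1 ∘L d)
      ext v
      simp [conj_apply, ← h, K₀.inv_self_fst]
  peiffer M N := by
    -- Clearing the inverse leaves `Φ_{∫δ M} N · M = M · N`.
    rw [eq_mul_inv_iff_mul_eq]
    apply Subtype.ext
    ext v
    have h := K₀.inv_self_fst (intδ d M) v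
    change (1 + M.1 ∘L d) (N.1 (((intδ d M)⁻¹).1.1.1 v)) + M.1 v +
      (1 + M.1 ∘L d) (N.1 (((intδ d M)⁻¹).1.1.1 (d (M.1 v)))) =
        M.1 v + N.1 v + M.1 (d (N.1 v))
    change ((intδ d M)⁻¹).1.1.1 (v + d (M.1 v)) = v at h
    -- With `g = I + d M`, this reads `g⁻¹ (d M v) = v - g⁻¹ v`, so the two terms in `g⁻¹` add up to
    -- `(I + M d) (N v)`.
    rw [map_add, ← eq_sub_iff_add_eq'] at h
    rw [h]
    simp
    abel

/-- The identification of the Lie algebra of `K₁` with `𝔨₁`. -/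
noncomputable def K₁.lieAlgebraEquiv : GroupLieAlgebra 𝓘(ℝ, V₀ →L[ℝ] V₁) (K₁ d) ≃ₗ[ℝ] k₁ d :=
  (k₁.toHom d).symm

/-- The identification of the Lie algebra of `K₀` with `𝔨₀`. -/
noncomputable def K₀.lieAlgebraEquiv : GroupLieAlgebra 𝓘(ℝ, k₀ d) (K₀ d) ≃ₗ[ℝ] k₀ d :=
  LinearEquiv.refl ℝ (k₀ d)

/-- `(Aut V, ∫δ, Φ)` differentiates to `(End V, δ, φ)`. -/
theorem isDifferentiation :
    IsDifferentiation 𝓘(ℝ, V₀ →L[ℝ] V₁) 𝓘(ℝ, k₀ d) (intδ d) (Φ d) (δ d) (φ d)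
      (K₁.lieAlgebraEquiv d) (K₀.lieAlgebraEquiv d) where
  -- Both identifications are the identity on the underlying vector spaces, so each field is an
  -- earlier formula up to definitional unfolding.
  map_lie₁ A B := K₁.groupLieAlgebra_bracket_eq A B
  map_lie₀ X Y := by
    have h := K₀.groupLieAlgebra_bracket_eq X Y
    exact h
  deriv_t A := by
    have h := tangentMorphism_intδ (d := d) A
    exact h
  differentiable_action A := by
    have h := mdifferentiableAt_conj (U := K₀ d) rfl (fun _ _ => rfl) (k₀.fst d) (k₀.snd d) A
      (tangentAction_Φ A)
    exact h
  deriv_action X A := by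
    have h := mfderiv_conj (U := K₀ d) rfl (fun _ _ => rfl) (k₀.fst d) (k₀.snd d) A
      (tangentAction_Φ A) X
    exact h

end TwoTerm

theorem mainTheorem3 {V₀ V₁ : Type*}
    [NormedAddCommGroup V₀] [NormedSpace ℝ V₀] [FiniteDimensional ℝ V₀]
    [NormedAddCommGroup V₁] [NormedSpace ℝ V₁] [FiniteDimensional ℝ V₁]
    (d : V₁ →L[ℝ] V₀) :
    -- the group laws of `K₁` and `K₀`, the map `∫δ` and the action `Φ`
    (∀ M : V₀ →L[ℝ] V₁, M ∈ TwoTerm.K₁ d ↔ IsUnit (1 + d ∘L M) ∧ IsUnit (1 + M ∘L d)) ∧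
    (∀ M N : TwoTerm.K₁ d, (↑(M * N) : V₀ →L[ℝ] V₁) = M.1 + N.1 + M.1 ∘L d ∘L N.1) ∧
    ((↑(1 : TwoTerm.K₁ d) : V₀ →L[ℝ] V₁) = 0) ∧
    (∀ (M : TwoTerm.K₁ d) (h₀ : IsUnit (1 + d ∘L M.1)) (h₁ : IsUnit (1 + M.1 ∘L d)),
      (↑(M⁻¹) : V₀ →L[ℝ] V₁) = -((↑(h₁.unit⁻¹) : V₁ →L[ℝ] V₁) ∘L M.1) ∧
      (↑(M⁻¹) : V₀ →L[ℝ] V₁) = -(M.1 ∘L (↑(h₀.unit⁻¹) : V₀ →L[ℝ] V₀))) ∧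
    (∀ B : TwoTerm.k₀ d, B ∈ TwoTerm.K₀ d ↔ IsUnit B.1.1 ∧ IsUnit B.1.2) ∧
    (∀ B C : TwoTerm.K₀ d, (↑(B * C) : TwoTerm.k₀ d) = B.1 * C.1) ∧
    (∀ M : TwoTerm.K₁ d, (TwoTerm.intδ d M).1.1 = (1 + d ∘L M.1, 1 + M.1 ∘L d)) ∧
    (∀ (B : TwoTerm.K₀ d) (M : TwoTerm.K₁ d),
      (TwoTerm.Φ d B M).1 = B.1.1.2 ∘L M.1 ∘L (B⁻¹).1.1.1) ∧
    -- `K₁` and `K₀` are Lie groups, and `Aut(V) = (K₁, K₀, ∫δ, Φ)` is a crossed module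
    LieGroup 𝓘(ℝ, V₀ →L[ℝ] V₁) ∞ (TwoTerm.K₁ d) ∧
    LieGroup 𝓘(ℝ, TwoTerm.k₀ d) ∞ (TwoTerm.K₀ d) ∧
    IsLieGroupCrossedModule 𝓘(ℝ, V₀ →L[ℝ] V₁) 𝓘(ℝ, TwoTerm.k₀ d)
      (TwoTerm.intδ d) (TwoTerm.Φ d) ∧
    -- `End(V) = (𝔨₁, 𝔨₀, δ, φ)` is a crossed module, and `Aut(V)` differentiates to it, where
    -- the tangent spaces are identified with `𝔨₁` and `𝔨₀` by the differentials of the inclusions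
    IsLieAlgebraCrossedModule (TwoTerm.δ d) (TwoTerm.φ d) ∧
    ∃ (e₁ : GroupLieAlgebra 𝓘(ℝ, V₀ →L[ℝ] V₁) (TwoTerm.K₁ d) ≃ₗ[ℝ] TwoTerm.k₁ d)
      (e₀ : GroupLieAlgebra 𝓘(ℝ, TwoTerm.k₀ d) (TwoTerm.K₀ d) ≃ₗ[ℝ] TwoTerm.k₀ d),
      (∀ A, TwoTerm.k₁.toHom d (e₁ A) =
        mfderiv 𝓘(ℝ, V₀ →L[ℝ] V₁) 𝓘(ℝ, V₀ →L[ℝ] V₁)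
          (Subtype.val : TwoTerm.K₁ d → V₀ →L[ℝ] V₁) 1 A) ∧
      (∀ X, e₀ X =
        mfderiv 𝓘(ℝ, TwoTerm.k₀ d) 𝓘(ℝ, TwoTerm.k₀ d)
          (Subtype.val : TwoTerm.K₀ d → TwoTerm.k₀ d) 1 X) ∧
      IsDifferentiation 𝓘(ℝ, V₀ →L[ℝ] V₁) 𝓘(ℝ, TwoTerm.k₀ d)
        (TwoTerm.intδ d) (TwoTerm.Φ d) (TwoTerm.δ d) (TwoTerm.φ d) e₁ e₀ := by
  refine ⟨fun _ => Iff.rfl, fun _ _ => rfl, rfl, fun M h₀ h₁ => ⟨rfl, TwoTerm.K₁.coe_inv' M h₀⟩,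
    fun _ => Iff.rfl, fun _ _ => rfl, fun _ => rfl, fun _ _ => rfl, inferInstance, inferInstance,
    TwoTerm.isLieGroupCrossedModule d, TwoTerm.isLieAlgebraCrossedModule d,
    TwoTerm.K₁.lieAlgebraEquiv d, TwoTerm.K₀.lieAlgebraEquiv d, fun A => ?_, fun X => ?_,
    TwoTerm.isDifferentiation d⟩
  · rw [TopologicalSpace.Opens.mfderiv_val]; rfl
  · rw [TopologicalSpace.Opens.mfderiv_val]; rfl
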